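/- Let $m\ge 1$ and let $S^{m-1}=\{x\in\mathbb{R}^m:\ x_k\ge 0,\ \sum_{k=1}^m x_k=1\}$. A Volterra quadratic stochastic operator with matrix $A=(a_{ki})_{k,i=1}^m$ is a map $V:S^{m-1}\to S^{m-1}$ of the form $$(V(x))_k=x_k\Bigl(1+\sum_{i=1}^m a_{ki}x_i\Bigr),\qquad k=1,\dots,m,$$ where $A$ is a real skew-symmetric matrix ($a_{ki}=-a_{ik}$) with $|a_{ki}|\le 1$ for all $k,i$. The operator $V$ is called transversal if all principal minors of even order of $A$ are nonzero. The Pfaffian of a skew-symmetric matrix $A$ of even order $n$ is defined recursively by $\operatorname{Pf}(A)=a_{12}$ for $n=2$ and $$\operatorname{Pf}(A)=\sum_{i=1}^{n-1}(-1)^{i-1}a_{in}\operatorname{Pf}(A_{in})\qquad (n>2),$$ where $A_{in}$ is $A$ with the $i$-th and $n$-th rows and columns deleted. For $1\le i_1<\dots<i_{2k}\le m$ let $gp_{i_1\dots i_{2k}}(A)$ be the Pfaffian of the principal submatrix of $A$ with rows and columns $i_1,\dots,i_{2k}$. Theorem. Let $V_0,V_1:S^{m-1}\to S^{m-1}$ be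 transversal Volterra quadratic stochastic operators with matrices $A^{(0)}$ and $A^{(1)}$. If $$\operatorname{sign}\bigl(gp_{i_1\dots i_{2k}}(A^{(0)})\bigr)=\operatorname{sign}\bigl(gp_{i_1\dots i_{2k}}(A^{(1)})\bigr)$$ for all $k\ge 1$ and all $1\le i_1<\dots<i_{2k}\le m$, then the sets $\{x\in S^{m-1}: V_0(x)=x\}$ and $\{x\in S^{m-1}: V_1(x)=x\}$ are finite and have the same number of elements. -/

import Mathlib

namespace Volterra

/-- `V` is the Volterra quadratic stochastic operator on the `(m-1)`-dimensional simplex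
with (skew-symmetric) coefficient matrix `A`. -/
structure IsVolterraQSO {m : ℕ} (V : stdSimplex ℝ (Fin m) → stdSimplex ℝ (Fin m))
    (A : Matrix (Fin m) (Fin m) ℝ) : Prop where
  skew : ∀ k i, A k i = -A i k
  abs_le_one : ∀ k i, |A k i| ≤ 1
  apply_eq : ∀ (x : stdSimplex ℝ (Fin m)) (k : Fin m),
    (V x : Fin m → ℝ) k
      = (x : Fin m → ℝ) k * (1 + ∑ i, A k i * (x : Fin m → ℝ) i)

/-- All principal minors of even order are nonzero. (The empty minor is `1`, so it
imposes no condition.) -/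
def IsTransversal {m : ℕ} (A : Matrix (Fin m) (Fin m) ℝ) : Prop :=
  ∀ s : Finset (Fin m), Even s.card →
    (A.submatrix (Subtype.val : s → Fin m) (Subtype.val : s → Fin m)).det ≠ 0

/-- The Pfaffian of a skew-symmetric matrix, by expansion along the last column:
with 0-based indices,
`Pf A = ∑ i, (-1)^i * A i last * Pf (A with the last and the i-th rows and columns deleted)`.
The map `fun a => (i.succAbove a).castSucc` enumerates increasingly the indices different
from `i` and from the last one. -/
def pfaffian {R : Type*} [CommRing R] : (n : ℕ) → Matrix (Fin n) (Fin n) R → R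
  | 0, _ => 1
  | 1, _ => 0
  | n + 2, A => ∑ i : Fin (n + 1), (-1) ^ (i : ℕ) * A i.castSucc (Fin.last (n + 1)) *
      pfaffian n (A.submatrix (fun a => (i.succAbove a).castSucc)
        (fun a => (i.succAbove a).castSucc))

/-- The principal sub-Pfaffian with rows and columns in `s`, listed in increasing order. -/
def subPfaffian {R : Type*} [CommRing R] {m : ℕ} (A : Matrix (Fin m) (Fin m) R)
    (s : Finset (Fin m)) : R :=
  pfaffian s.card (A.submatrix (s.orderEmbOfFin rfl) (s.orderEmbOfFin rfl))

end Volterra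

/-! A fixed point is determined by its support, and the Pfaffian signs decide which supports occur.
On its support `s`, a fixed point `x` restricts to a positive kernel vector of the principal
submatrix `A_s`, so transversality forces `|s|` to be odd. Then the kernel of `A_s` is a line,
spanned by the vector of signed sub-Pfaffians (`mulVec_pfaffianVec`, `pfaffian_ne_zero`), and `x` is
that vector normalised to sum 1. Conversely, if the normalised vector is positive, extending it by
zero gives a fixed point. Positivity means that all its entries share one sign, so both operators
have the same set of supports. -/

namespace Volterra

/-! ### Pfaffians of Gram matrices as alternating forms. -/

section Alternating

variable {R M : Type*} [CommRing R] [AddCommGroup M] [Module R M]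

/-- The exterior product of a linear form `c` with an alternating form `P`. -/
noncomputable def wedge {n : ℕ} (c : M →ₗ[R] R) (P : M [⋀^Fin n]→ₗ[R] R) :
    M [⋀^Fin (n + 1)]→ₗ[R] R :=
  AlternatingMap.alternatizeUncurryFin (LinearMap.smulRight c P)

theorem wedge_apply {n : ℕ} (c : M →ₗ[R] R) (P : M [⋀^Fin n]→ₗ[R] R) (v : Fin (n + 1) → M) :
    wedge c P v = ∑ i : Fin (n + 1), (-1) ^ (i : ℕ) * c (v i) * P (i.removeNth v) := by
  simp [wedge, AlternatingMap.alternatizeUncurryFin_apply, mul_assoc]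

theorem wedge_wedge_self {n : ℕ} (c : M →ₗ[R] R) (P : M [⋀^Fin n]→ₗ[R] R) :
    wedge c (wedge c P) = 0 := by
  have h := AlternatingMap.alternatizeUncurryFin_alternatizeUncurryFinLM_comp_of_symmetric
    (f := LinearMap.smulRight c (LinearMap.smulRight c P))
    (fun x y => by simp [smul_smul, mul_comm])
  rw [← h, wedge]
  congr 1
  ext x : 1
  simp [wedge]

/-- The Pfaffian of the Gram matrix of `v` with respect to the bilinear form `B`. -/
def gramPfaffian (B : M →ₗ[R] M →ₗ[R] R) (n : ℕ) (v : Fin n → M) : R :=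
  pfaffian n (Matrix.of fun i j => B (v i) (v j))

theorem gramPfaffian_add_two (B : M →ₗ[R] M →ₗ[R] R) {n : ℕ} (P : M [⋀^Fin n]→ₗ[R] R)
    (hP : ∀ v, P v = gramPfaffian B n v) (v : Fin (n + 2) → M) :
    gramPfaffian B (n + 2) v = wedge (B.flip (v (Fin.last _))) P (Fin.init v) := by
  rw [wedge_apply]
  simp only [hP]
  rfl

/-- For `i` last, put `c = B(·, w i)`: the last term contains `B(w i, w i) = 0`, and expanding `P`
in the others along their last vector, again `w i`, leaves `c ∧ (c ∧ Q) = 0`. A transposition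
reduces any other `i` to this case. -/
theorem wedge_apply_eq_zero (B : M →ₗ[R] M →ₗ[R] R) (hB : ∀ x, B x x = 0) {n : ℕ}
    (P : M [⋀^Fin n]→ₗ[R] R) (hP : ∀ v, P v = gramPfaffian B n v)
    (hrec : ∀ k, n = k + 2 → ∃ Q : M [⋀^Fin k]→ₗ[R] R, ∀ v, Q v = gramPfaffian B k v)
    (w : Fin (n + 1) → M) (i : Fin (n + 1)) : wedge (B.flip (w i)) P w = 0 := by
  have key : ∀ w : Fin (n + 1) → M, wedge (B.flip (w (Fin.last n))) P w = 0 := by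
    intro w
    rw [wedge_apply, Fin.sum_univ_castSucc]
    simp only [LinearMap.flip_apply, hB, mul_zero, zero_mul, add_zero]
    match n, P, hP, hrec, w with
    | 0, _, _, _, _ => simp
    | 1, P, hP, _, _ => simp [hP, gramPfaffian, pfaffian]
    | k + 2, P, hP, hrec, w =>
      obtain ⟨Q, hQ⟩ := hrec k rfl
      have h0 : wedge (B.flip (w (Fin.last (k + 2)))) (wedge (B.flip (w (Fin.last (k + 2)))) Q)
          (Fin.init w) = 0 := by rw [wedge_wedge_self, AlternatingMap.zero_apply]
      rw [← h0, wedge_apply]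
      refine Finset.sum_congr rfl fun j _ => ?_
      rw [hP, gramPfaffian_add_two B Q hQ]
      have h1 : j.castSucc.removeNth w (Fin.last (k + 1)) = w (Fin.last (k + 2)) := by
        simp [Fin.removeNth_apply]
      have h2 : Fin.init (j.castSucc.removeNth w) = j.removeNth (Fin.init w) := by
        ext a
        simp [Fin.init, Fin.removeNth_apply, Fin.castSucc_succAbove_castSucc]
      rw [h1, h2]
      rfl
  by_cases hi : i = Fin.last n
  · rw [hi, key]
  · have h := key (w ∘ Equiv.swap i (Fin.last n))
    rw [AlternatingMap.map_swap _ _ hi] at h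
    simpa using h

/-- The alternating form sending `(v₀, …, vₙ, x)` to `(B(·, x) ∧ P)(v₀, …, vₙ)`. -/
noncomputable def wedgeLast (B : M →ₗ[R] M →ₗ[R] R) {n : ℕ} (P : M [⋀^Fin n]→ₗ[R] R)
    (h : ∀ (w : Fin (n + 1) → M) (i : Fin (n + 1)), wedge (B.flip (w i)) P w = 0) :
    M [⋀^Fin (n + 2)]→ₗ[R] R where
  toMultilinearMap := MultilinearMap.mk'
    (fun v => wedge (B.flip (v (Fin.last _))) P (Fin.init v))
    (by
      intro v i x y
      induction i using Fin.lastCases with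
      | last => simp [wedge_apply, mul_add, add_mul, Finset.sum_add_distrib]
      | cast i => simp [Fin.init_update_castSucc, Function.update_of_ne (Fin.castSucc_ne_last i).symm])
    (by
      intro v i c x
      induction i using Fin.lastCases with
      | last => simp [wedge_apply, Finset.mul_sum, mul_assoc, mul_left_comm]
      | cast i => simp [Fin.init_update_castSucc, Function.update_of_ne (Fin.castSucc_ne_last i).symm])
  map_eq_zero_of_eq' := by
    intro v i j hv hij
    change wedge (B.flip (v (Fin.last _))) P (Fin.init v) = 0
    induction i using Fin.lastCases with
    | last =>
      induction j using Fin.lastCases with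
      | last => exact absurd rfl hij
      | cast j => rw [hv]; exact h (Fin.init v) j
    | cast i =>
      induction j using Fin.lastCases with
      | last => rw [← hv]; exact h (Fin.init v) i
      | cast j =>
        exact AlternatingMap.map_eq_zero_of_eq _ _ (i := i) (j := j) hv
          fun e => hij (congrArg _ e)

theorem exists_alternatingMap_eq_gramPfaffian (B : M →ₗ[R] M →ₗ[R] R) (hB : ∀ x, B x x = 0)
    (n : ℕ) : ∃ P : M [⋀^Fin n]→ₗ[R] R, ∀ v, P v = gramPfaffian B n v := by
  induction n using Nat.strong_induction_on with
  | _ n ih =>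
    match n, ih with
    | 0, _ => exact ⟨AlternatingMap.constOfIsEmpty R M (Fin 0) 1, fun v => rfl⟩
    | 1, _ => exact ⟨0, fun v => rfl⟩
    | n + 2, ih =>
      obtain ⟨P, hP⟩ := ih n (by omega)
      refine ⟨wedgeLast B P (wedge_apply_eq_zero B hB P hP fun k hk => ih k (by omega)),
        fun v => ?_⟩
      rw [gramPfaffian_add_two B P hP]
      rfl

end Alternating

/-! ### Kernel vectors built from sub-Pfaffians. -/

theorem pfaffian_submatrix_eq_zero {K : Type*} [Field K] [CharZero K] {ι : Type*} [Fintype ι]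
    [DecidableEq ι] {A : Matrix ι ι K} (hA : ∀ i j, A i j = -A j i) {n : ℕ} (f : Fin n → ι)
    {i j : Fin n} (hf : f i = f j) (hij : i ≠ j) : pfaffian n (A.submatrix f f) = 0 := by
  let B : (ι → K) →ₗ[K] (ι → K) →ₗ[K] K := Matrix.toLinearMap₂' K A
  have hB : ∀ x, B x x = 0 := by
    intro x
    have h : B x x = -B x x := by
      conv_lhs => rw [Matrix.toLinearMap₂'_apply, Finset.sum_comm]
      rw [Matrix.toLinearMap₂'_apply, ← Finset.sum_neg_distrib]
      refine Finset.sum_congr rfl fun a _ => ?_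
      rw [← Finset.sum_neg_distrib]
      refine Finset.sum_congr rfl fun b _ => ?_
      rw [hA b a]
      simp only [smul_eq_mul]
      ring
    exact self_eq_neg.mp h
  obtain ⟨P, hP⟩ := exists_alternatingMap_eq_gramPfaffian B hB n
  have h := P.map_eq_zero_of_eq (fun a => Pi.single (f a) (1 : K)) (i := i) (j := j)
    (by rw [hf]) hij
  rw [hP, gramPfaffian] at h
  rw [← h]
  congr 1
  ext a b
  have h1 : B (Pi.single (f a) 1) (Pi.single (f b) 1) = A (f a) (f b) := by
    rw [Matrix.toLinearMap₂'_apply']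
    simp
  exact h1.symm

/-- The vector of signed sub-Pfaffians. -/
def pfaffianVec {R : Type*} [CommRing R] {n : ℕ} (A : Matrix (Fin (n + 1)) (Fin (n + 1)) R)
    (j : Fin (n + 1)) : R :=
  (-1) ^ (j : ℕ) * pfaffian n (A.submatrix j.succAbove j.succAbove)

theorem mulVec_pfaffianVec {K : Type*} [Field K] [CharZero K] {n : ℕ}
    {A : Matrix (Fin (n + 1)) (Fin (n + 1)) K} (hA : ∀ i j, A i j = -A j i) :
    A.mulVec (pfaffianVec A) = 0 := by
  ext i
  -- Repeating index `i` at the end makes the Pfaffian vanish; its expansion along the last column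
  -- is minus row `i` of the product.
  have h := pfaffian_submatrix_eq_zero hA (Fin.snoc (α := fun _ => Fin (n + 1)) id i)
    (i := i.castSucc) (j := Fin.last _) (by simp) (Fin.castSucc_ne_last i)
  rw [pfaffian] at h
  simp only [Matrix.mulVec, dotProduct, Pi.zero_apply]
  rw [← neg_eq_zero, ← h, ← Finset.sum_neg_distrib]
  refine Finset.sum_congr rfl fun j _ => ?_
  have hs : (A.submatrix (Fin.snoc (α := fun _ => Fin (n + 1)) id i)
      (Fin.snoc (α := fun _ => Fin (n + 1)) id i)).submatrix
      (fun a => (j.succAbove a).castSucc) (fun a => (j.succAbove a).castSucc) =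
      A.submatrix j.succAbove j.succAbove := by
    ext a b
    simp
  rw [hs, hA i j, pfaffianVec]
  simp
  ring

/-- Induction replaces the identity `det = Pf²`: if `Pf A = 0`, the kernel vector of the leading
block, padded with 0, is a nonzero kernel vector of `A`. -/
theorem pfaffian_ne_zero {K : Type*} [Field K] [CharZero K] {n : ℕ} (hn : Even n)
    {A : Matrix (Fin n) (Fin n) K} (hA : ∀ i j, A i j = -A j i)
    (hdet : ∀ (k : ℕ) (g : Fin k → Fin n), Even k → Function.Injective g →
      (A.submatrix g g).det ≠ 0) : pfaffian n A ≠ 0 := by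
  induction n using Nat.strong_induction_on with
  | _ n ih =>
    match n, ih, hn, A, hA, hdet with
    | 0, _, _, _, _, _ => simp [pfaffian]
    | 1, _, hn, _, _, _ => exact absurd hn (by decide)
    | n + 2, ih, hn, A, hA, hdet =>
      intro h0
      have hn' : Even n := by simpa [Nat.even_add] using hn
      set C := A.submatrix (Fin.castSucc (n := n + 1)) Fin.castSucc with hC
      have hv : pfaffianVec C 0 ≠ 0 := by
        refine mul_ne_zero (by simp) (ih n (by omega) hn' (fun _ _ => hA _ _) ?_)
        intro k g hk hg
        exact hdet k _ hk ((Fin.castSucc_injective _).comp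
          ((Fin.succAbove_right_injective (p := 0)).comp hg))
      have hCv := mulVec_pfaffianVec (A := C) (fun _ _ => hA _ _)
      let w : Fin (n + 2) → K := Fin.snoc (α := fun _ => K) (pfaffianVec C) 0
      have hw : A.mulVec w = 0 := by
        ext i
        rw [Matrix.mulVec, dotProduct, Fin.sum_univ_castSucc]
        simp only [w, Fin.snoc_castSucc, Fin.snoc_last, mul_zero, add_zero, Pi.zero_apply]
        induction i using Fin.lastCases with
        | last =>
          -- By skew-symmetry the last entry of the product is `-Pf A`.
          rw [← neg_eq_zero, ← h0, pfaffian, ← Finset.sum_neg_distrib]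
          refine Finset.sum_congr rfl fun j _ => ?_
          rw [hA (Fin.last _), pfaffianVec]
          change _ = _ * pfaffian n (C.submatrix j.succAbove j.succAbove)
          ring
        | cast i => exact congrFun hCv i
      have hw0 := Matrix.eq_zero_of_mulVec_eq_zero (hdet _ id hn Function.injective_id) hw
      exact hv (by simpa [w] using congrFun hw0 (Fin.castSucc 0))

theorem det_submatrix_ne_zero {m : ℕ} {A : Matrix (Fin m) (Fin m) ℝ} (h : IsTransversal A)
    {k : ℕ} (hk : Even k) {g : Fin k → Fin m} (hg : Function.Injective g) :
    (A.submatrix g g).det ≠ 0 := by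
  have hc : (Finset.univ.map ⟨g, hg⟩).card = k := by simp
  have := h (Finset.univ.map ⟨g, hg⟩) (by rwa [hc])
  let e : Fin k ≃ (Finset.univ.map ⟨g, hg⟩ : Finset (Fin m)) :=
    Equiv.ofBijective (fun a => ⟨g a, by simp⟩)
      ⟨fun a b hab => hg (congrArg Subtype.val hab), fun ⟨b, hb⟩ => by
        obtain ⟨a, -, rfl⟩ := Finset.mem_map.1 hb
        exact ⟨a, rfl⟩⟩
  rwa [← Matrix.det_submatrix_equiv_self e] at this

theorem subPfaffian_map {R : Type*} [CommRing R] {m k : ℕ} (A : Matrix (Fin m) (Fin m) R)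
    (g : Fin k ↪o Fin m) :
    subPfaffian A (Finset.univ.map g.toEmbedding) = pfaffian k (A.submatrix g g) := by
  have hk : (Finset.univ.map g.toEmbedding).card = k := by simp
  have hg : g = (Finset.univ.map g.toEmbedding).orderEmbOfFin hk :=
    Finset.orderEmbOfFin_unique' hk (by simp)
  unfold subPfaffian
  generalize Finset.univ.map g.toEmbedding = s at *
  subst hk
  rw [← hg]

/-- A vector annihilated by `A` and vanishing at some coordinate is zero, provided that the
corresponding principal minors do not vanish. -/
theorem eq_zero_of_mulVec_eq_zero_of_apply_eq_zero {K : Type*} [Field K] {n : ℕ}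
    {A : Matrix (Fin (n + 1)) (Fin (n + 1)) K} (j : Fin (n + 1))
    (hdet : (A.submatrix j.succAbove j.succAbove).det ≠ 0) {x : Fin (n + 1) → K}
    (hx : A.mulVec x = 0) (hj : x j = 0) : x = 0 := by
  have h : (A.submatrix j.succAbove j.succAbove).mulVec (x ∘ j.succAbove) = 0 := by
    ext i
    have := congrFun hx (j.succAbove i)
    simpa [Matrix.mulVec, dotProduct, Fin.sum_univ_succAbove _ j, hj] using this
  have h0 := Matrix.eq_zero_of_mulVec_eq_zero hdet h
  ext i
  rcases Fin.eq_self_or_eq_succAbove j i with rfl | ⟨a, rfl⟩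
  · exact hj
  · exact congrFun h0 a

/-! ### Fixed points and their supports. -/

/-- The set of nonzero coordinates of a point of the simplex. -/
noncomputable def simplexSupport {m : ℕ} (x : stdSimplex ℝ (Fin m)) : Finset (Fin m) :=
  Finset.univ.filter fun k => (x : Fin m → ℝ) k ≠ 0

theorem mem_simplexSupport {m : ℕ} {x : stdSimplex ℝ (Fin m)} {k : Fin m} :
    k ∈ simplexSupport x ↔ (x : Fin m → ℝ) k ≠ 0 := by
  simp [simplexSupport]

variable {m : ℕ} {V : stdSimplex ℝ (Fin m) → stdSimplex ℝ (Fin m)}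
  {A : Matrix (Fin m) (Fin m) ℝ}

theorem IsVolterraQSO.mem_fixedPoints_iff (hV : IsVolterraQSO V A) (x : stdSimplex ℝ (Fin m)) :
    x ∈ Function.fixedPoints V ↔
      ∀ k, (x : Fin m → ℝ) k * ∑ i, A k i * (x : Fin m → ℝ) i = 0 := by
  rw [Function.mem_fixedPoints, Function.IsFixedPt, Subtype.ext_iff, funext_iff]
  refine forall_congr' fun k => ?_
  change (V x : Fin m → ℝ) k = (x : Fin m → ℝ) k ↔ _
  rw [hV.apply_eq, mul_add, mul_one, add_eq_left]

theorem sum_comp_eq_sum {n : ℕ} {x : stdSimplex ℝ (Fin m)} {g : Fin n ↪o Fin m}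
    (hg : Finset.univ.map g.toEmbedding = simplexSupport x) (c : Fin m → ℝ) :
    ∑ a, c (g a) * (x : Fin m → ℝ) (g a) = ∑ i, c i * (x : Fin m → ℝ) i := by
  have h := Finset.sum_map Finset.univ g.toEmbedding fun i => c i * (x : Fin m → ℝ) i
  rw [hg] at h
  refine h.symm.trans (Finset.sum_subset (Finset.subset_univ _) fun i _ hi => ?_)
  rw [mem_simplexSupport, not_not] at hi
  rw [hi, mul_zero]

theorem sum_comp_eq_one {n : ℕ} {x : stdSimplex ℝ (Fin m)} {g : Fin n ↪o Fin m}
    (hg : Finset.univ.map g.toEmbedding = simplexSupport x) :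
    ∑ a, (x : Fin m → ℝ) (g a) = 1 := by
  have h := sum_comp_eq_sum hg 1
  simp only [Pi.one_apply, one_mul] at h
  rw [h]
  exact x.2.2

theorem IsVolterraQSO.mulVec_comp_eq_zero (hV : IsVolterraQSO V A) {x : stdSimplex ℝ (Fin m)}
    (hx : x ∈ Function.fixedPoints V) {n : ℕ} {g : Fin n ↪o Fin m}
    (hg : Finset.univ.map g.toEmbedding = simplexSupport x) :
    (A.submatrix g g).mulVec (fun a => (x : Fin m → ℝ) (g a)) = 0 := by
  ext a
  refine (sum_comp_eq_sum hg (A (g a))).trans ?_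
  have ha : g a ∈ simplexSupport x := by simp [← hg]
  exact (mul_eq_zero.1 ((hV.mem_fixedPoints_iff x).1 hx (g a))).resolve_left
    (mem_simplexSupport.1 ha)

theorem IsVolterraQSO.not_even_of_mem_fixedPoints (hV : IsVolterraQSO V A)
    (hA : IsTransversal A) {x : stdSimplex ℝ (Fin m)} (hx : x ∈ Function.fixedPoints V) {n : ℕ}
    {g : Fin n ↪o Fin m} (hg : Finset.univ.map g.toEmbedding = simplexSupport x) :
    ¬ Even n := by
  intro hn
  have h := Matrix.eq_zero_of_mulVec_eq_zero (det_submatrix_ne_zero hA hn g.injective)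
    (hV.mulVec_comp_eq_zero hx hg)
  have h1 := sum_comp_eq_one hg
  simp [funext_iff] at h
  simp [h] at h1

theorem IsVolterraQSO.apply_eq_of_mem_fixedPoints (hV : IsVolterraQSO V A)
    (hA : IsTransversal A) {x : stdSimplex ℝ (Fin m)} (hx : x ∈ Function.fixedPoints V) {n : ℕ}
    (hn : Even n) {g : Fin (n + 1) ↪o Fin m}
    (hg : Finset.univ.map g.toEmbedding = simplexSupport x) (a : Fin (n + 1)) :
    (x : Fin m → ℝ) (g a) =
      pfaffianVec (A.submatrix g g) a / ∑ b, pfaffianVec (A.submatrix g g) b := by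
  have hskew : ∀ i j, A.submatrix g g i j = -A.submatrix g g j i := fun _ _ => hV.skew _ _
  set v := pfaffianVec (A.submatrix g g) with hv
  have hinj : Function.Injective (g ∘ (0 : Fin (n + 1)).succAbove) :=
    g.injective.comp Fin.succAbove_right_injective
  have hv0 : v 0 ≠ 0 := mul_ne_zero (by simp) (pfaffian_ne_zero hn (fun _ _ => hskew _ _)
    fun k f hk hf => det_submatrix_ne_zero hA hk (hinj.comp hf))
  -- This combination of two kernel vectors is chosen to vanish at coordinate 0, so it is zero and
  -- the two are proportional.
  have hz := eq_zero_of_mulVec_eq_zero_of_apply_eq_zero (A := A.submatrix g g) 0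
    (det_submatrix_ne_zero hA hn hinj)
    (x := v 0 • (fun a => (x : Fin m → ℝ) (g a)) - (x : Fin m → ℝ) (g 0) • v)
    (by rw [Matrix.mulVec_sub, Matrix.mulVec_smul, Matrix.mulVec_smul,
          hV.mulVec_comp_eq_zero hx hg, mulVec_pfaffianVec hskew, smul_zero, smul_zero, sub_zero])
    (by simp [mul_comm])
  have h1 : ∀ a, v 0 * (x : Fin m → ℝ) (g a) = (x : Fin m → ℝ) (g 0) * v a := fun a =>
    sub_eq_zero.1 (congrFun hz a)
  have h2 : v 0 = (x : Fin m → ℝ) (g 0) * ∑ b, v b := by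
    rw [Finset.mul_sum, ← Finset.sum_congr rfl fun a _ => h1 a, ← Finset.mul_sum,
      sum_comp_eq_one hg, mul_one]
  have hs : ∑ b, v b ≠ 0 := fun h => hv0 (by rw [h2, h, mul_zero])
  rw [eq_div_iff hs]
  refine mul_left_cancel₀ hv0 ?_
  rw [← mul_assoc, h1, h2]
  ring

theorem exists_orderEmb_map_eq {s : Finset (Fin m)} {n : ℕ} (h : s.card = n) :
    ∃ g : Fin n ↪o Fin m, Finset.univ.map g.toEmbedding = s :=
  ⟨s.orderEmbOfFin h, Finset.coe_injective (by simp)⟩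

theorem IsVolterraQSO.exists_orderEmb (hV : IsVolterraQSO V A) (hA : IsTransversal A)
    {x : stdSimplex ℝ (Fin m)} (hx : x ∈ Function.fixedPoints V) :
    ∃ (n : ℕ) (g : Fin (n + 1) ↪o Fin m), Even n ∧
      Finset.univ.map g.toEmbedding = simplexSupport x := by
  obtain ⟨g, hg⟩ := exists_orderEmb_map_eq (s := simplexSupport x) rfl
  have hodd := hV.not_even_of_mem_fixedPoints hA hx hg
  obtain ⟨k, hk⟩ := Nat.not_even_iff_odd.1 hodd
  obtain ⟨g', hg'⟩ := exists_orderEmb_map_eq hk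
  exact ⟨2 * k, g', even_two_mul k, hg'⟩

theorem IsVolterraQSO.injOn_simplexSupport (hV : IsVolterraQSO V A) (hA : IsTransversal A) :
    Set.InjOn simplexSupport (Function.fixedPoints V) := by
  intro x hx y hy hxy
  obtain ⟨n, g, hn, hg⟩ := hV.exists_orderEmb hA hx
  ext k
  by_cases hk : k ∈ simplexSupport x
  · obtain ⟨a, -, rfl⟩ := Finset.mem_map.1 (hg ▸ hk)
    exact (hV.apply_eq_of_mem_fixedPoints hA hx hn hg a).trans
      (hV.apply_eq_of_mem_fixedPoints hA hy hn (hg.trans hxy) a).symm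
  · have hk' := hxy ▸ hk
    rw [mem_simplexSupport, not_not] at hk hk'
    exact hk.trans hk'.symm

theorem IsVolterraQSO.exists_mem_fixedPoints (hV : IsVolterraQSO V A) {n : ℕ}
    (g : Fin (n + 1) ↪o Fin m)
    (hpos : ∀ a, 0 < pfaffianVec (A.submatrix g g) a / ∑ b, pfaffianVec (A.submatrix g g) b) :
    ∃ x ∈ Function.fixedPoints V, simplexSupport x = Finset.univ.map g.toEmbedding := by
  have hskew : ∀ i j, A.submatrix g g i j = -A.submatrix g g j i := fun _ _ => hV.skew _ _
  set v := pfaffianVec (A.submatrix g g) with hv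
  set y : Fin (n + 1) → ℝ := fun a => v a / ∑ b, v b with hy
  have hs : ∑ b, v b ≠ 0 := fun h => by simpa [h] using hpos 0
  let x : Fin m → ℝ := Function.extend g y 0
  have hxg : ∀ a, x (g a) = y a := fun a => g.injective.extend_apply _ _ _
  have hx0 : ∀ k, k ∉ Finset.univ.map g.toEmbedding → x k = 0 := fun k hk =>
    Function.extend_apply' _ _ _ fun ⟨a, ha⟩ => hk (by simp [← ha])
  have hsum : ∀ c : Fin m → ℝ, ∑ i, c i * x i = ∑ a, c (g a) * y a := by
    intro c
    have h := Finset.sum_map Finset.univ g.toEmbedding fun i => c i * x i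
    rw [Finset.sum_subset (Finset.subset_univ _) fun i _ hi => by rw [hx0 i hi, mul_zero]] at h
    exact h.trans (Finset.sum_congr rfl fun a _ => congrArg (c (g a) * ·) (hxg a))
  have hxmem : x ∈ stdSimplex ℝ (Fin m) := by
    refine ⟨fun k => ?_, ?_⟩
    · by_cases hk : k ∈ Finset.univ.map g.toEmbedding
      · obtain ⟨a, -, rfl⟩ := Finset.mem_map.1 hk
        exact (hpos a).le.trans_eq (hxg a).symm
      · exact (hx0 k hk).ge
    · have h := hsum 1
      simp only [Pi.one_apply, one_mul] at h
      rw [h, hy, ← Finset.sum_div, div_self hs]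
  refine ⟨⟨x, hxmem⟩, (hV.mem_fixedPoints_iff _).2 fun k => ?_, ?_⟩
  · change x k * ∑ i, A k i * x i = 0
    by_cases hk : k ∈ Finset.univ.map g.toEmbedding
    · obtain ⟨a, -, rfl⟩ := Finset.mem_map.1 hk
      have h : ∑ b, A (g a) (g b) * v b = 0 := congrFun (mulVec_pfaffianVec hskew) a
      refine mul_eq_zero_of_right _ ((hsum _).trans ?_)
      change ∑ b, A (g a) (g b) * (v b / ∑ b, v b) = 0
      simp only [← mul_div_assoc]
      rw [← Finset.sum_div, h, zero_div]
    · rw [hx0 k hk, zero_mul]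
  · ext k
    rw [mem_simplexSupport]
    change x k ≠ 0 ↔ _
    refine ⟨fun h => by_contra fun hk => h (hx0 k hk), fun hk => ?_⟩
    obtain ⟨a, -, rfl⟩ := Finset.mem_map.1 hk
    exact ((hpos a).trans_eq (hxg a).symm).ne'

/-- Positive quotients force every `v a` to have the sign of the sum; `w` inherits this common sign.
-/
theorem div_sum_pos_of_sign_eq {ι : Type*} [Fintype ι] [Nonempty ι] {v w : ι → ℝ}
    (h : ∀ a, SignType.sign (v a) = SignType.sign (w a)) (hv : ∀ a, 0 < v a / ∑ b, v b) (a : ι) :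
    0 < w a / ∑ b, w b := by
  rcases lt_trichotomy (∑ b, v b) 0 with hs | hs | hs
  · have hw : ∀ a, w a < 0 := fun a => by
      rw [← sign_eq_neg_one_iff, ← h, sign_eq_neg_one_iff]
      exact ((div_pos_iff.1 (hv a)).resolve_left fun h => hs.not_gt h.2).1
    exact div_pos_of_neg_of_neg (hw a)
      (Finset.sum_neg (fun b _ => hw b) Finset.univ_nonempty)
  · simpa [hs] using hv a
  · have hw : ∀ a, 0 < w a := fun a => by
      rw [← sign_eq_one_iff, ← h, sign_eq_one_iff]
      exact (div_pos_iff_of_pos_right hs).1 (hv a)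
    exact div_pos (hw a) (Finset.sum_pos (fun b _ => hw b) Finset.univ_nonempty)

theorem sign_pfaffianVec_eq {A₀ A₁ : Matrix (Fin m) (Fin m) ℝ}
    (hsign : ∀ s : Finset (Fin m), Even s.card →
      SignType.sign (subPfaffian A₀ s) = SignType.sign (subPfaffian A₁ s))
    {n : ℕ} (hn : Even n) (g : Fin (n + 1) ↪o Fin m) (a : Fin (n + 1)) :
    SignType.sign (pfaffianVec (A₀.submatrix g g) a) =
      SignType.sign (pfaffianVec (A₁.submatrix g g) a) := by
  have h := hsign (Finset.univ.map (a.succAboveOrderEmb.trans g).toEmbedding) (by simpa using hn)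
  rw [subPfaffian_map, subPfaffian_map] at h
  rw [pfaffianVec, pfaffianVec, sign_mul, sign_mul]
  exact congrArg _ h

theorem image_simplexSupport_subset {V₀ V₁ : stdSimplex ℝ (Fin m) → stdSimplex ℝ (Fin m)}
    {A₀ A₁ : Matrix (Fin m) (Fin m) ℝ} (hV₀ : IsVolterraQSO V₀ A₀) (hV₁ : IsVolterraQSO V₁ A₁)
    (ht₀ : IsTransversal A₀)
    (hsign : ∀ s : Finset (Fin m), Even s.card →
      SignType.sign (subPfaffian A₀ s) = SignType.sign (subPfaffian A₁ s)) :
    simplexSupport '' Function.fixedPoints V₀ ⊆ simplexSupport '' Function.fixedPoints V₁ := by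
  rintro _ ⟨x, hx, rfl⟩
  obtain ⟨n, g, hn, hg⟩ := hV₀.exists_orderEmb ht₀ hx
  obtain ⟨y, hy, hys⟩ := hV₁.exists_mem_fixedPoints g <|
    div_sum_pos_of_sign_eq (sign_pfaffianVec_eq hsign hn g) fun a => by
      rw [← hV₀.apply_eq_of_mem_fixedPoints ht₀ hx hn hg a]
      have ha : g a ∈ simplexSupport x := by simp [← hg]
      exact lt_of_le_of_ne (x.2.1 _) (mem_simplexSupport.1 ha).symm
  exact ⟨y, hy, hys.trans hg⟩

end Volterra

theorem mainTheorem2 {m : ℕ}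
    (V₀ V₁ : stdSimplex ℝ (Fin m) → stdSimplex ℝ (Fin m))
    (A₀ A₁ : Matrix (Fin m) (Fin m) ℝ)
    (hV₀ : Volterra.IsVolterraQSO V₀ A₀) (hV₁ : Volterra.IsVolterraQSO V₁ A₁)
    (ht₀ : Volterra.IsTransversal A₀) (ht₁ : Volterra.IsTransversal A₁)
    (hsign : ∀ s : Finset (Fin m), Even s.card →
      SignType.sign (Volterra.subPfaffian A₀ s) = SignType.sign (Volterra.subPfaffian A₁ s)) :
    (Function.fixedPoints V₀).Finite ∧ (Function.fixedPoints V₁).Finite ∧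
      (Function.fixedPoints V₀).ncard = (Function.fixedPoints V₁).ncard := by
  have hi₀ := hV₀.injOn_simplexSupport ht₀
  have hi₁ := hV₁.injOn_simplexSupport ht₁
  refine ⟨Set.Finite.of_finite_image (Set.toFinite _) hi₀,
    Set.Finite.of_finite_image (Set.toFinite _) hi₁, ?_⟩
  rw [← hi₀.ncard_image, ← hi₁.ncard_image]
  exact congrArg _ ((Volterra.image_simplexSupport_subset hV₀ hV₁ ht₀ hsign).antisymm
    (Volterra.image_simplexSupport_subset hV₁ hV₀ ht₁ fun s hs => (hsign s hs).symm))
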